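/- Let $m,n\ge 1$. A seller sells $m$ items to $n$ buyers in $m$ consecutive stages, one item per stage. For each stage $k$ let $V_k\subseteq[0,\infty)$ be a Borel set (e.g. an interval or a finite set) and $X_k$ a random variable whose distribution is concentrated on $V_k$. The value $v^i_k$ of buyer $i$ for item $k$ has the distribution of $X_k$, and all the values $v^i_k$ ($1\le i\le n$, $1\le k\le m$) are independent. Write $\mathbf v_{\le k}=(v^i_l)_{l\le k,\,1\le i\le n}$, and similarly $\mathbf v_{<k}$; $v^i_k$ is learned by buyer $i$ at the beginning of stage $k$. A (direct) dynamic mechanism consists of measurable winning probabilities $x^i_k(\mathbf v_{\le k})$ and payments $p^i_k(\mathbf v_{\le k})$, functions of the reports up to stage $k$, with $p^i_k$ of finite expectation, $x^i_k(\mathbf v_{\le k})\in[0,1]$ and $\sum_i x^i_k(\mathbf v_{\le k})\le 1$ for all $\mathbf v_{\le k}$ with entries in the $V_l$. It is *ex-post IR* if $v^i_kx^i_k(\mathbf v_{\le k})-p^i_k(\mathbf v_{\le k})\ge 0$ for all $i$, $k$ and all $\mathbf v_{\le k}$. It is *periodic IC* if for every buyer $i$, stage $k$, history $\mathbf v_{<k}$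 and value $v^i_k\in V_k$, the report $\hat v^i_k=v^i_k$ maximizes over $\hat v^i_k\in V_k$ the expectation, over the values of the other buyers in stage $k$ and of all buyers in later stages, of $$\sum_{l\ge k}\Big(v^i_l\,x^i_l(\hat{\mathbf v}_{\le l})-p^i_l(\hat{\mathbf v}_{\le l})\Big),$$ where $\hat{\mathbf v}$ is the profile $\mathbf v$ with $v^i_k$ replaced by $\hat v^i_k$. (Expectations may be infinite.) Let $\mathrm{OPT}(\mathcal X,n,m)$ be the supremum of the expected revenues $\mathbb E\big[\sum_{k}\sum_i p^i_k(\mathbf v_{\le k})\big]$ of ex-post IR and periodic IC dynamic mechanisms, and let $\mathrm{Mye}(\mathbf X_j)$ be the optimal revenue in a one-shot auction of one item to $n$ buyers with i.i.d. values distributed as $X_j$, i.e. the supremum of the expected revenues of the feasible, Bayesian incentive compatible and ex-post IR one-shot direct mechanisms with value space $V_j$ (the revenue of Myerson's optimal auction). Let $(X_k)_{1:n}$ be the largest of $n$ independent samples of $X_k$. Then $$\mathrm{OPT}(\mathcal X,n,m)\;\le\;\min_{j=1,\dots,m}\Big\{\mathrm{Mye}(\mathbf X_j)+\sum_{k\ne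 j}\mathbb E\big[(X_k)_{1:n}\big]\Big\}.$$ -/

import Mathlib

open MeasureTheory
open scoped ENNReal

namespace DynAuction

noncomputable section

/-- Expectation with values in the extended reals, `𝔼[f⁺] - 𝔼[f⁻]`. It is the usual expectation as
soon as one of the two parts is finite, which is always the case where it is used below. -/
def expect {Ω : Type*} [MeasurableSpace Ω] (P : Measure Ω) (f : Ω → ℝ) : EReal :=
  ((∫⁻ ω, ENNReal.ofReal (f ω) ∂P : ℝ≥0∞) : EReal) -
    ((∫⁻ ω, ENNReal.ofReal (-f ω) ∂P : ℝ≥0∞) : EReal)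

/-- The law of the values of `n` i.i.d. buyers in a stage with value distribution `μ`. -/
def stageLaw (n : ℕ) (μ : Measure ℝ) : Measure (Fin n → ℝ) :=
  Measure.pi fun _ => μ

/-- The expected highest order statistic `𝔼[X_{1:n}]` of `n` i.i.d. samples from `μ`. -/
def expectedMax (n : ℕ) (μ : Measure ℝ) : EReal :=
  expect (stageLaw n μ) fun w => ⨆ i, w i

/-! ### One-shot auctions -/

/-- A direct one-shot auction for `n` buyers: winning probabilities and payments as functions of
the reported values. -/
structure StaticMechanism (n : ℕ) where
  /-- `alloc w i` is the probability that buyer `i` wins on reports `w`. -/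
  alloc : (Fin n → ℝ) → Fin n → ℝ
  /-- `pay w i` is the payment of buyer `i` on reports `w`. -/
  pay : (Fin n → ℝ) → Fin n → ℝ

/-- Interim expected utility of buyer `i` with value `t` who reports `r`, when the other buyers
report truthfully. -/
def StaticMechanism.interimUtility {n : ℕ} (M : StaticMechanism n) (μ : Measure ℝ)
    (i : Fin n) (t r : ℝ) : EReal :=
  expect (stageLaw n μ) fun w =>
    t * M.alloc (Function.update w i r) i - M.pay (Function.update w i r) i

/-- The feasible, Bayesian incentive compatible, ex-post individually rational one-shot auctions
for `n` i.i.d. buyers with value space `V` and value distribution `μ`. -/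
structure StaticMechanism.IsAdmissible {n : ℕ} (M : StaticMechanism n) (V : Set ℝ)
    (μ : Measure ℝ) : Prop where
  measurable_alloc : Measurable M.alloc
  measurable_pay : Measurable M.pay
  integrable_pay : ∀ i, Integrable (fun w => M.pay w i) (stageLaw n μ)
  alloc_mem : ∀ w, (∀ a, w a ∈ V) → ∀ i, M.alloc w i ∈ Set.Icc (0 : ℝ) 1
  sum_alloc_le : ∀ w, (∀ a, w a ∈ V) → ∑ i, M.alloc w i ≤ 1
  incentiveCompatible : ∀ i, ∀ t ∈ V, ∀ r ∈ V,
    M.interimUtility μ i t r ≤ M.interimUtility μ i t t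
  exPostIR : ∀ w, (∀ a, w a ∈ V) → ∀ i, 0 ≤ w i * M.alloc w i - M.pay w i

/-- Expected revenue of a one-shot auction under truthful reporting. -/
def StaticMechanism.revenue {n : ℕ} (M : StaticMechanism n) (μ : Measure ℝ) : ℝ :=
  ∫ w, ∑ i, M.pay w i ∂(stageLaw n μ)

/-- The revenue of the optimal (Myerson) one-shot auction for `n` i.i.d. buyers. -/
def myerson (n : ℕ) (V : Set ℝ) (μ : Measure ℝ) : EReal :=
  ⨆ (M : StaticMechanism n) (_ : M.IsAdmissible V μ), (M.revenue μ : EReal)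

/-! ### Dynamic auctions -/

/-- A profile of values (or reports): `v k i` is the value of buyer `i` in stage `k`. -/
abbrev Profile (m n : ℕ) := Fin m → Fin n → ℝ

/-- All values in stage `k` lie in the value space `V k` of that stage. -/
def IsProfileIn {m n : ℕ} (V : Fin m → Set ℝ) (v : Profile m n) : Prop :=
  ∀ k i, v k i ∈ V k

/-- The joint law of all values: independent across stages and across buyers, with distribution
`μ k` for every buyer in stage `k`. -/
def jointLaw {m : ℕ} (n : ℕ) (μ : Fin m → Measure ℝ) : Measure (Profile m n) :=
  Measure.pi fun k => stageLaw n (μ k)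

/-- A direct dynamic mechanism: winning probabilities and payments in every stage. That those of
stage `k` depend on the reports of stages up to `k` only is part of `IsAdmissible`. -/
structure Mechanism (m n : ℕ) where
  /-- `alloc k v i` is the probability that buyer `i` gets the item of stage `k`. -/
  alloc : Fin m → Profile m n → Fin n → ℝ
  /-- `pay k v i` is the payment of buyer `i` in stage `k`. -/
  pay : Fin m → Profile m n → Fin n → ℝ

/-- The profile that agrees with the history `h` before stage `k`, has the entry `t` for buyer `i`
in stage `k`, and agrees with `w` in all other entries (the other buyers in stage `k` and everybody
in later stages). -/
def splice {m n : ℕ} (k : Fin m) (i : Fin n) (h : Profile m n) (t : ℝ) (w : Profile m n) :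
    Profile m n :=
  fun l a => if l < k then h l a else if l = k ∧ a = i then t else w l a

/-- Expected utility of buyer `i` from stage `k` on, after the history `h` of reports in the stages
before `k`, if her value in stage `k` is `t`, she reports `r` in stage `k` and is truthful in all
later stages, and the other buyers are truthful. The expectation is over the values of the other
buyers in stage `k` and of all buyers in later stages. -/
def Mechanism.continuationUtility {m n : ℕ} (M : Mechanism m n) (μ : Fin m → Measure ℝ)
    (k : Fin m) (i : Fin n) (h : Profile m n) (t r : ℝ) : EReal :=
  expect (jointLaw n μ) fun w =>
    ∑ l ∈ Finset.Ici k,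
      (splice k i h t w l i * M.alloc l (splice k i h r w) i - M.pay l (splice k i h r w) i)

/-- Periodic incentive compatibility: for every buyer, stage, history and value, the truth is
optimal among all current reports, given truthful reports in the future. -/
def Mechanism.PeriodicIC {m n : ℕ} (M : Mechanism m n) (V : Fin m → Set ℝ)
    (μ : Fin m → Measure ℝ) : Prop :=
  ∀ (i : Fin n) (k : Fin m) (h : Profile m n), IsProfileIn V h → ∀ t ∈ V k, ∀ r ∈ V k,
    M.continuationUtility μ k i h t r ≤ M.continuationUtility μ k i h t t

/-- Ex-post individual rationality: every stage utility is nonnegative on every history. -/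
def Mechanism.ExPostIR {m n : ℕ} (M : Mechanism m n) (V : Fin m → Set ℝ) : Prop :=
  ∀ (i : Fin n) (k : Fin m) (v : Profile m n), IsProfileIn V v →
    0 ≤ v k i * M.alloc k v i - M.pay k v i

/-- The feasible, periodic incentive compatible, ex-post individually rational dynamic mechanisms
(with measurable allocations and payments, and payments of finite expectation). -/
structure Mechanism.IsAdmissible {m n : ℕ} (M : Mechanism m n) (V : Fin m → Set ℝ)
    (μ : Fin m → Measure ℝ) : Prop where
  adapted_alloc : ∀ (k : Fin m) (v w : Profile m n), (∀ l ≤ k, v l = w l) →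
    M.alloc k v = M.alloc k w
  adapted_pay : ∀ (k : Fin m) (v w : Profile m n), (∀ l ≤ k, v l = w l) →
    M.pay k v = M.pay k w
  measurable_alloc : ∀ k, Measurable (M.alloc k)
  measurable_pay : ∀ k, Measurable (M.pay k)
  integrable_pay : ∀ k i, Integrable (fun v => M.pay k v i) (jointLaw n μ)
  alloc_mem : ∀ k v, IsProfileIn V v → ∀ i, M.alloc k v i ∈ Set.Icc (0 : ℝ) 1
  sum_alloc_le : ∀ k v, IsProfileIn V v → ∑ i, M.alloc k v i ≤ 1
  periodicIC : M.PeriodicIC V μ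
  exPostIR : M.ExPostIR V

/-- Expected total revenue of a dynamic mechanism under truthful reporting. -/
def Mechanism.revenue {m n : ℕ} (M : Mechanism m n) (μ : Fin m → Measure ℝ) : ℝ :=
  ∫ v, ∑ k, ∑ i, M.pay k v i ∂(jointLaw n μ)

/-- The optimal revenue `OPT(𝒳, n, m)` of ex-post IR, periodic IC dynamic mechanisms. -/
def opt {m : ℕ} (n : ℕ) (V : Fin m → Set ℝ) (μ : Fin m → Measure ℝ) : EReal :=
  ⨆ (M : Mechanism m n) (_ : M.IsAdmissible V μ), (M.revenue μ : EReal)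

end

end DynAuction

/-! Fix an admissible mechanism and a stage `j`. Given a history before `j`, run stage `j` as a
one-shot auction in which each buyer receives in advance, as a reduction of the payment, the
expected utility that the reports of stage `j` promise for later stages (`afterHistory`). Periodic
IC at stage `j` is exactly Bayesian IC of this auction. Ex-post IR survives because later stage
utilities are nonnegative. So its revenue is at most Myerson's, and averaging over histories bounds
the expected stage-`j` payments minus later utilities (`integral_virtual_revenue_le`).

The remaining revenue is bounded pointwise by welfare (`sum_pay_le`). Before `j`, payments are at
most the welfare of their stage. After `j`, payments plus the utilities subtracted above equal the
welfare. Welfare of a stage never exceeds its highest value.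

The delicate point is integrability. One-shot IC concerns every report in the value space, including
reports of probability zero, while Fubini controls only almost every report;
`integrable_utilityFrom` closes this gap by means of IC itself. -/

namespace DynAuction

noncomputable section

/-! ### Resampling coordinates of a product measure -/

section Pi

variable {ι : Type*} [Fintype ι] {X : ι → Type*} [∀ i, MeasurableSpace (X i)]
  (ν : ∀ i, Measure (X i)) [∀ i, IsProbabilityMeasure (ν i)]

lemma measurePreserving_ite (p : ι → Prop) [DecidablePred p] :
    MeasurePreserving (fun q : (∀ i, X i) × (∀ i, X i) => fun i => if p i then q.1 i else q.2 i)
      ((Measure.pi ν).prod (Measure.pi ν)) (Measure.pi ν) := by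
  have hmeas : Measurable
      (fun q : (∀ i, X i) × (∀ i, X i) => fun i => if p i then q.1 i else q.2 i) := by
    refine measurable_pi_lambda _ fun i => ?_
    by_cases h : p i <;> simp only [h, if_true, if_false] <;> fun_prop
  refine ⟨hmeas, (Measure.pi_eq fun s hs => ?_).symm⟩
  rw [Measure.map_apply hmeas (MeasurableSet.univ_pi hs)]
  have : (fun q : (∀ i, X i) × (∀ i, X i) => fun i => if p i then q.1 i else q.2 i) ⁻¹'
      Set.univ.pi s = (Set.univ.pi fun i => if p i then s i else Set.univ) ×ˢ
        (Set.univ.pi fun i => if p i then Set.univ else s i) := by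
    ext q
    simp only [Set.mem_preimage, Set.mem_univ_pi, Set.mem_prod, ← forall_and]
    refine forall_congr' fun i => ?_
    by_cases h : p i <;> simp [h]
  rw [this, Measure.prod_prod, Measure.pi_pi, Measure.pi_pi, ← Finset.prod_mul_distrib]
  refine Finset.prod_congr rfl fun i _ => ?_
  by_cases h : p i <;> simp [h]

lemma measurePreserving_update [DecidableEq ι] (i : ι) :
    MeasurePreserving (fun q : X i × (∀ i, X i) => Function.update q.2 i q.1)
      ((ν i).prod (Measure.pi ν)) (Measure.pi ν) := by
  have hmeas : Measurable (fun q : X i × (∀ i, X i) => Function.update q.2 i q.1) := by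
    refine measurable_pi_lambda _ fun a => ?_
    by_cases h : a = i
    · subst h; simpa using measurable_fst
    · simp only [Function.update_of_ne h]; fun_prop
  refine ⟨hmeas, (Measure.pi_eq fun s hs => ?_).symm⟩
  rw [Measure.map_apply hmeas (MeasurableSet.univ_pi hs)]
  have : (fun q : X i × (∀ i, X i) => Function.update q.2 i q.1) ⁻¹' Set.univ.pi s =
      s i ×ˢ (Set.univ.pi (Function.update s i Set.univ)) := by
    ext q
    simp only [Set.mem_preimage, Set.mem_univ_pi, Set.mem_prod]
    constructor
    · intro h
      refine ⟨by simpa using h i, fun a => ?_⟩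
      by_cases ha : a = i
      · subst ha; simp
      · simpa [ha] using h a
    · rintro ⟨h₁, h₂⟩ a
      by_cases ha : a = i
      · subst ha; simpa using h₁
      · simpa [ha] using h₂ a
  rw [this, Measure.prod_prod, Measure.pi_pi,
    ← Finset.mul_prod_erase Finset.univ _ (Finset.mem_univ i),
    ← Finset.mul_prod_erase Finset.univ (fun a => ν a (s a)) (Finset.mem_univ i)]
  simp only [Function.update_self, measure_univ, one_mul]
  congr 1
  refine Finset.prod_congr rfl fun a ha => ?_
  rw [Function.update_of_ne (Finset.ne_of_mem_erase ha)]

end Pi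

/-! ### Extended-real expectations -/

section Expect

variable {Ω : Type*} [MeasurableSpace Ω] {P : Measure Ω} {f g : Ω → ℝ}

lemma expect_eq_integral (hf : Integrable f P) : expect P f = ((∫ ω, f ω ∂P : ℝ) : EReal) := by
  have h₁ : ∫⁻ ω, ENNReal.ofReal (f ω) ∂P ≠ ∞ := hf.lintegral_lt_top.ne
  have h₂ : ∫⁻ ω, ENNReal.ofReal (-f ω) ∂P ≠ ∞ := hf.neg.lintegral_lt_top.ne
  rw [expect, integral_eq_lintegral_pos_part_sub_lintegral_neg_part hf, EReal.coe_sub,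
    EReal.coe_ennreal_toReal h₁, EReal.coe_ennreal_toReal h₂]

lemma expect_congr_ae (h : f =ᵐ[P] g) : expect P f = expect P g := by
  unfold expect
  have h₁ : ∫⁻ ω, ENNReal.ofReal (f ω) ∂P = ∫⁻ ω, ENNReal.ofReal (g ω) ∂P :=
    lintegral_congr_ae (h.mono fun ω hω => congrArg ENNReal.ofReal hω)
  have h₂ : ∫⁻ ω, ENNReal.ofReal (-f ω) ∂P = ∫⁻ ω, ENNReal.ofReal (-g ω) ∂P :=
    lintegral_congr_ae (h.mono fun ω hω => congrArg (fun x => ENNReal.ofReal (-x)) hω)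
  rw [h₁, h₂]

lemma expect_comp {Ω' : Type*} [MeasurableSpace Ω'] {P' : Measure Ω'} {φ : Ω' → Ω}
    (hφ : MeasurePreserving φ P' P) (hf : Measurable f) :
    expect P' (fun ω => f (φ ω)) = expect P f := by
  have hneg : Measurable fun ω => ENNReal.ofReal (-f ω) := hf.neg.ennreal_ofReal
  unfold expect
  rw [hφ.lintegral_comp hf.ennreal_ofReal, hφ.lintegral_comp hneg]

/-- A random variable bounded below by an integrable one is integrable if its expectation is not
`⊤`. -/
lemma integrable_of_expect_ne_top (hf : AEStronglyMeasurable f P) (hg : Integrable g P)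
    (hgf : ∀ᵐ ω ∂P, g ω ≤ f ω) (h : expect P f ≠ ⊤) : Integrable f P := by
  have hneg : ∫⁻ ω, ENNReal.ofReal (-f ω) ∂P ≠ ∞ :=
    ((lintegral_mono_ae (hgf.mono fun ω hω => ENNReal.ofReal_le_ofReal (neg_le_neg hω))).trans_lt
      hg.neg.lintegral_lt_top).ne
  -- The negative part must be finite first: since `⊤ - ⊤ = ⊥` in `EReal`, an expectation different
  -- from `⊤` alone would not exclude an infinite positive part.
  have hpos : ∫⁻ ω, ENNReal.ofReal (f ω) ∂P ≠ ∞ := by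
    intro htop
    apply h
    rw [expect, htop, ← EReal.coe_ennreal_toReal hneg]
    rfl
  refine ⟨hf, ?_⟩
  have hle : ∀ ω, ‖f ω‖ₑ ≤ ENNReal.ofReal (f ω) + ENNReal.ofReal (-f ω) := fun ω => by
    rw [← ofReal_norm, Real.norm_eq_abs]
    rcases le_total 0 (f ω) with h0 | h0
    · rw [abs_of_nonneg h0]; exact le_self_add
    · rw [abs_of_nonpos h0]; exact le_add_self
  refine (lintegral_mono hle).trans_lt ?_
  rw [lintegral_add_left' hf.aemeasurable.ennreal_ofReal]
  exact ENNReal.add_lt_top.2 ⟨hpos.lt_top, hneg.lt_top⟩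

end Expect

/-! ### Decomposing profiles into history, stage `j` and future -/

section Glue

variable {m n : ℕ}

instance (n : ℕ) (ν : Measure ℝ) [IsProbabilityMeasure ν] : IsProbabilityMeasure (stageLaw n ν) := by
  unfold stageLaw; infer_instance

instance (n : ℕ) (μ : Fin m → Measure ℝ) [∀ k, IsProbabilityMeasure (μ k)] :
    IsProbabilityMeasure (jointLaw n μ) := by
  unfold jointLaw; infer_instance

lemma ae_stageLaw_mem {V : Set ℝ} {ν : Measure ℝ} [IsProbabilityMeasure ν]
    (hV : ∀ᵐ t ∂ν, t ∈ V) : ∀ᵐ w ∂(stageLaw n ν), ∀ i, w i ∈ V :=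
  ae_all_iff.2 fun i => (measurePreserving_eval (fun _ : Fin n => ν) i).quasiMeasurePreserving.ae hV

lemma ae_jointLaw_isProfileIn {V : Fin m → Set ℝ} {μ : Fin m → Measure ℝ}
    [∀ k, IsProbabilityMeasure (μ k)] (hV : ∀ k, ∀ᵐ t ∂(μ k), t ∈ V k) :
    ∀ᵐ v ∂(jointLaw n μ), IsProfileIn V v :=
  ae_all_iff.2 fun k => (measurePreserving_eval (fun k => stageLaw n (μ k)) k).quasiMeasurePreserving.ae
    (ae_stageLaw_mem (hV k))

/-- The profile with history `h` before stage `j`, values `w` in stage `j` and future `u`. -/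
def glue (j : Fin m) (h : Profile m n) (w : Fin n → ℝ) (u : Profile m n) : Profile m n :=
  fun l => if l < j then h l else Function.update u j w l

@[simp] lemma glue_self (j : Fin m) (h : Profile m n) (w : Fin n → ℝ) (u : Profile m n) :
    glue j h w u j = w := by simp [glue]

lemma glue_congr_of_le (j : Fin m) (h : Profile m n) (w : Fin n → ℝ) (u u' : Profile m n) :
    ∀ l ≤ j, glue j h w u l = glue j h w u' l := by
  intro l hl
  rcases hl.lt_or_eq with hl | rfl
  · simp [glue, hl]
  · simp

lemma glue_update (j : Fin m) (h : Profile m n) (w w' : Fin n → ℝ) (u : Profile m n) :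
    glue j h w (Function.update u j w') = glue j h w u := by
  unfold glue; simp only [Function.update_idem]

lemma splice_eq_glue (j : Fin m) (i : Fin n) (h : Profile m n) (r : ℝ) (u : Profile m n) :
    splice j i h r u = glue j h (Function.update (u j) i r) u := by
  funext l a
  unfold splice glue
  split_ifs with h1 h2
  · rfl
  · obtain ⟨rfl, rfl⟩ := h2; simp
  · by_cases hl : l = j
    · subst hl
      have : a ≠ i := fun ha => h2 ⟨rfl, ha⟩
      simp [this]
    · simp [hl]

lemma IsProfileIn.glue {V : Fin m → Set ℝ} {j : Fin m} {h u : Profile m n} {w : Fin n → ℝ}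
    (hh : IsProfileIn V h) (hw : ∀ a, w a ∈ V j) (hu : IsProfileIn V u) :
    IsProfileIn V (glue j h w u) := by
  intro l a
  rcases lt_trichotomy l j with hl | rfl | hl
  · simpa [DynAuction.glue, hl] using hh l a
  · simpa using hw a
  · simpa [DynAuction.glue, hl.not_gt, hl.ne'] using hu l a

lemma measurable_update_value (i : Fin n) (r : ℝ) :
    Measurable fun w : Fin n → ℝ => Function.update w i r :=
  (measurable_update' (X := fun _ => ℝ) (a := i)).comp (measurable_id.prodMk measurable_const)

lemma measurable_glue (j : Fin m) :
    Measurable fun q : Profile m n × ((Fin n → ℝ) × Profile m n) => glue j q.1 q.2.1 q.2.2 := by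
  refine measurable_pi_lambda _ fun l => ?_
  unfold glue
  rcases lt_trichotomy l j with hl | rfl | hl
  · simp only [hl, if_true]; fun_prop
  · simp only [lt_irrefl, if_false, Function.update_self]; fun_prop
  · simp only [hl.not_gt, if_false, Function.update_of_ne hl.ne']; fun_prop

/-- Stages are independent, so past, present and future may come from separate draws. This permits
conditioning on a history by Fubini. -/
lemma measurePreserving_glue (μ : Fin m → Measure ℝ) [∀ k, IsProbabilityMeasure (μ k)]
    (j : Fin m) :
    MeasurePreserving
      (fun q : Profile m n × ((Fin n → ℝ) × Profile m n) => glue j q.1 q.2.1 q.2.2)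
      ((jointLaw n μ).prod ((stageLaw n (μ j)).prod (jointLaw n μ))) (jointLaw n μ) :=
  (measurePreserving_ite (fun k => stageLaw n (μ k)) (fun l => l < j)).comp
    ((MeasurePreserving.id (jointLaw n μ)).prod
      (measurePreserving_update (fun k => stageLaw n (μ k)) j))

end Glue

/-! ### Continuation utilities from stage `j` on -/

namespace Mechanism

variable {m n : ℕ} (M : Mechanism m n)

/-- The utility of buyer `i` in stage `k` under truthful reporting. -/
def stageUtility (k : Fin m) (v : Profile m n) (i : Fin n) : ℝ :=
  v k i * M.alloc k v i - M.pay k v i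

/-- The total utility of buyer `i` in the stages after `j` under truthful reporting. -/
def laterUtility (j : Fin m) (v : Profile m n) (i : Fin n) : ℝ :=
  ∑ l ∈ Finset.Ioi j, M.stageUtility l v i

/-- The realized utility from stage `j` on of buyer `i` with stage value `t`, if the reports are
`v` and buyer `i` is truthful after stage `j`. -/
def utilityFrom (j : Fin m) (t : ℝ) (v : Profile m n) (i : Fin n) : ℝ :=
  t * M.alloc j v i - M.pay j v i + M.laterUtility j v i

variable {M} {V : Fin m → Set ℝ} {μ : Fin m → Measure ℝ}

namespace IsAdmissible

lemma measurable_stageUtility (hM : M.IsAdmissible V μ) (k : Fin m) (i : Fin n) :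
    Measurable fun v => M.stageUtility k v i := by
  have h₁ := measurable_pi_iff.1 (hM.measurable_alloc k) i
  have h₂ := measurable_pi_iff.1 (hM.measurable_pay k) i
  unfold stageUtility
  fun_prop

lemma measurable_laterUtility (hM : M.IsAdmissible V μ) (j : Fin m) (i : Fin n) :
    Measurable fun v => M.laterUtility j v i :=
  Finset.measurable_sum _ fun l _ => hM.measurable_stageUtility l i

lemma measurable_utilityFrom (hM : M.IsAdmissible V μ) (j : Fin m) (t : ℝ) (i : Fin n) :
    Measurable fun v => M.utilityFrom j t v i := by
  have h₁ := measurable_pi_iff.1 (hM.measurable_alloc j) i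
  have h₂ := measurable_pi_iff.1 (hM.measurable_pay j) i
  have h₃ := hM.measurable_laterUtility j i
  unfold utilityFrom
  fun_prop

lemma laterUtility_nonneg (hM : M.IsAdmissible V μ) (j : Fin m) (i : Fin n) {v : Profile m n}
    (hv : IsProfileIn V v) : 0 ≤ M.laterUtility j v i :=
  Finset.sum_nonneg fun l _ => hM.exPostIR i l v hv

/-- `splice` takes the rivals' stage-`j` values and the future from one draw. Resampling coordinate
`j` of that draw preserves its law, and `glue` ignores the future's own entry at `j`, so the two
become independent. -/
lemma continuationUtility_eq [∀ k, IsProbabilityMeasure (μ k)] (hM : M.IsAdmissible V μ)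
    (j : Fin m) (i : Fin n) (h : Profile m n) (t r : ℝ) :
    M.continuationUtility μ j i h t r =
      expect ((stageLaw n (μ j)).prod (jointLaw n μ))
        fun q => M.utilityFrom j t (glue j h (Function.update q.1 i r) q.2) i := by
  have hint : ∀ u : Profile m n, ∑ l ∈ Finset.Ici j,
      (splice j i h t u l i * M.alloc l (splice j i h r u) i - M.pay l (splice j i h r u) i) =
      M.utilityFrom j t (glue j h (Function.update (u j) i r) u) i := by
    intro u
    rw [← Finset.Ioi_insert, Finset.sum_insert (by simp), utilityFrom, ← splice_eq_glue]
    congr 1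
    · simp [splice]
    · refine Finset.sum_congr rfl fun l hl => ?_
      have hl' := Finset.mem_Ioi.1 hl
      simp [stageUtility, splice, hl'.ne', hl'.not_gt]
  have hmeas : Measurable fun u : Profile m n =>
      M.utilityFrom j t (glue j h (Function.update (u j) i r) u) i := by
    refine (hM.measurable_utilityFrom j t i).comp ((measurable_glue j).comp
      (measurable_const.prodMk (Measurable.prodMk ?_ measurable_id)))
    exact (measurable_update_value i r).comp (measurable_pi_apply j)
  unfold continuationUtility
  simp only [hint]
  rw [jointLaw, ← expect_comp (measurePreserving_update (fun k => stageLaw n (μ k)) j) hmeas]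
  simp only [Function.update_self, glue_update]

end IsAdmissible

end Mechanism

/-! ### The one-shot auction induced by a history -/

namespace Mechanism

variable {m n : ℕ}

/-- The one-shot auction played in stage `j` after the history `h`, in which every buyer is handed
her expected utility from later stages in advance. -/
def afterHistory (M : Mechanism m n) (μ : Fin m → Measure ℝ) (j : Fin m) (h : Profile m n) :
    StaticMechanism n where
  alloc w i := M.alloc j (glue j h w h) i
  pay w i := M.pay j (glue j h w h) i - ∫ u, M.laterUtility j (glue j h w u) i ∂(jointLaw n μ)

variable {M : Mechanism m n} {V : Fin m → Set ℝ} {μ : Fin m → Measure ℝ}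

namespace IsAdmissible

lemma alloc_glue (hM : M.IsAdmissible V μ) (j : Fin m) (h : Profile m n) (w : Fin n → ℝ)
    (u : Profile m n) : M.alloc j (glue j h w u) = M.alloc j (glue j h w h) :=
  hM.adapted_alloc j _ _ (glue_congr_of_le j h w u h)

lemma pay_glue (hM : M.IsAdmissible V μ) (j : Fin m) (h : Profile m n) (w : Fin n → ℝ)
    (u : Profile m n) : M.pay j (glue j h w u) = M.pay j (glue j h w h) :=
  hM.adapted_pay j _ _ (glue_congr_of_le j h w u h)

variable [∀ k, IsProbabilityMeasure (μ k)] {j : Fin m} {h : Profile m n}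

lemma ae_isProfileIn_glue (hμV : ∀ k, ∀ᵐ t ∂(μ k), t ∈ V k) (hh : IsProfileIn V h) :
    ∀ᵐ q ∂((stageLaw n (μ j)).prod (jointLaw n μ)), IsProfileIn V (glue j h q.1 q.2) := by
  filter_upwards [Measure.quasiMeasurePreserving_fst.ae (ae_stageLaw_mem (hμV j)),
    Measure.quasiMeasurePreserving_snd.ae (ae_jointLaw_isProfileIn hμV)] with q h₁ h₂
  exact hh.glue h₁ h₂

lemma ae_isProfileIn_glue_update (hμV : ∀ k, ∀ᵐ t ∂(μ k), t ∈ V k) (hh : IsProfileIn V h)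
    (i : Fin n) {r : ℝ} (hr : r ∈ V j) :
    ∀ᵐ q ∂((stageLaw n (μ j)).prod (jointLaw n μ)),
      IsProfileIn V (glue j h (Function.update q.1 i r) q.2) := by
  filter_upwards [Measure.quasiMeasurePreserving_fst.ae (ae_stageLaw_mem (hμV j)),
    Measure.quasiMeasurePreserving_snd.ae (ae_jointLaw_isProfileIn hμV)] with q h₁ h₂
  refine hh.glue (fun a => ?_) h₂
  by_cases ha : a = i
  · subst ha; simpa using hr
  · simpa [ha] using h₁ a

lemma measurable_glue_update (j : Fin m) (h : Profile m n) (i : Fin n) (r : ℝ) :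
    Measurable fun q : (Fin n → ℝ) × Profile m n => glue j h (Function.update q.1 i r) q.2 :=
  (measurable_glue j).comp (measurable_const.prodMk
    (((measurable_update_value i r).comp measurable_fst).prodMk measurable_snd))

/-- Some stage type has a finite continuation utility under truthful reporting. -/
lemma exists_integrable_utilityFrom (hM : M.IsAdmissible V μ)
    (hμV : ∀ k, ∀ᵐ t ∂(μ k), t ∈ V k) (hh : IsProfileIn V h) (i : Fin n)
    (hp : Integrable (fun q => M.pay j (glue j h q.1 q.2) i)
      ((stageLaw n (μ j)).prod (jointLaw n μ)))
    (hB : Integrable (fun q => M.laterUtility j (glue j h q.1 q.2) i)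
      ((stageLaw n (μ j)).prod (jointLaw n μ))) :
    ∃ t ∈ V j, Integrable
      (fun q => M.utilityFrom j t (glue j h (Function.update q.1 i t) q.2) i)
      ((stageLaw n (μ j)).prod (jointLaw n μ)) := by
  have key : ∀ F : (Fin n → ℝ) × Profile m n → ℝ,
      Integrable F ((stageLaw n (μ j)).prod (jointLaw n μ)) →
      ∀ᵐ t ∂(μ j), Integrable (fun q => F (Function.update q.1 i t, q.2))
        ((stageLaw n (μ j)).prod (jointLaw n μ)) := by
    intro F hF
    -- Overwriting buyer `i`'s entry by an independent draw `t` preserves the law. With `t`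
    -- reassociated to the outside, Fubini gives integrable sections for almost every `t`.
    have hmp := ((measurePreserving_update (fun _ : Fin n => μ j) i).prod
      (MeasurePreserving.id (jointLaw n μ))).comp
      ((measurePreserving_prodAssoc (μ j) (Measure.pi fun _ : Fin n => μ j) (jointLaw n μ)).symm)
    exact (hmp.integrable_comp_of_integrable hF).prod_right_ae
  obtain ⟨t, ⟨ht, htp⟩, htB⟩ := (((hμV j).and (key _ hp)).and (key _ hB)).exists
  refine ⟨t, ht, ?_⟩
  have hx : Integrable (fun q => t * M.alloc j (glue j h (Function.update q.1 i t) q.2) i)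
      ((stageLaw n (μ j)).prod (jointLaw n μ)) := by
    refine Integrable.of_bound (C := |t|) (((measurable_pi_iff.1 (hM.measurable_alloc j) i).comp
      (measurable_glue_update j h i t)).const_mul t).aestronglyMeasurable ?_
    filter_upwards [ae_isProfileIn_glue_update hμV hh i ht] with q hq
    have := hM.alloc_mem j _ hq i
    rw [norm_mul, Real.norm_eq_abs, Real.norm_eq_abs, abs_of_nonneg this.1]
    exact mul_le_of_le_one_right (abs_nonneg t) this.2
  exact (hx.sub htp).add htB

/-- Some type `s` has finite utility from truth, so by IC type `s` cannot gain infinitely from any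
report `r`. Passing from `s` to another type `t` changes the utility only by the bounded term `(t -
s) * alloc`. -/
lemma integrable_utilityFrom (hM : M.IsAdmissible V μ)
    (hμV : ∀ k, ∀ᵐ t ∂(μ k), t ∈ V k) (hh : IsProfileIn V h) (i : Fin n)
    (hp : Integrable (fun q => M.pay j (glue j h q.1 q.2) i)
      ((stageLaw n (μ j)).prod (jointLaw n μ)))
    (hB : Integrable (fun q => M.laterUtility j (glue j h q.1 q.2) i)
      ((stageLaw n (μ j)).prod (jointLaw n μ))) (t : ℝ) {r : ℝ} (hr : r ∈ V j) :
    Integrable (fun q => M.utilityFrom j t (glue j h (Function.update q.1 i r) q.2) i)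
      ((stageLaw n (μ j)).prod (jointLaw n μ)) := by
  obtain ⟨s, hs, hsint⟩ := hM.exists_integrable_utilityFrom hμV hh i hp hB
  have hmeas : ∀ t, Measurable fun q : (Fin n → ℝ) × Profile m n =>
      M.utilityFrom j t (glue j h (Function.update q.1 i r) q.2) i := fun t =>
    (hM.measurable_utilityFrom j t i).comp (measurable_glue_update j h i r)
  have hsr : Integrable (fun q => M.utilityFrom j s (glue j h (Function.update q.1 i r) q.2) i)
      ((stageLaw n (μ j)).prod (jointLaw n μ)) := by
    -- The lower bound: type `r` reporting `r` has nonnegative utility by ex-post IR, and type `s`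
    -- differs from it by `(s - r) * alloc`, which is at least `-|s - r|`.
    refine integrable_of_expect_ne_top (hmeas s).aestronglyMeasurable
      (integrable_const (-|s - r|)) ?_ ?_
    · filter_upwards [ae_isProfileIn_glue_update hμV hh i hr] with q hq
      have h₁ := hM.alloc_mem j _ hq i
      have h₂ := hM.exPostIR i j _ hq
      have h₃ := hM.laterUtility_nonneg j i hq
      rw [glue_self, Function.update_self] at h₂
      have h₄ : -|s - r| ≤ (s - r) * M.alloc j (glue j h (Function.update q.1 i r) q.2) i := by
        refine le_trans ?_ (neg_abs_le _)
        rw [abs_mul, abs_of_nonneg h₁.1, neg_le_neg_iff]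
        exact mul_le_of_le_one_right (abs_nonneg _) h₁.2
      unfold utilityFrom
      linarith
    · rw [← hM.continuationUtility_eq]
      refine ((hM.periodicIC i j h hh s hs r hr).trans_lt ?_).ne
      rw [hM.continuationUtility_eq, expect_eq_integral hsint]
      exact EReal.coe_lt_top _
  have hx : Integrable
      (fun q => (t - s) * M.alloc j (glue j h (Function.update q.1 i r) q.2) i)
      ((stageLaw n (μ j)).prod (jointLaw n μ)) := by
    refine Integrable.of_bound (C := |t - s|) (((measurable_pi_iff.1 (hM.measurable_alloc j) i).comp
      (measurable_glue_update j h i r)).const_mul _).aestronglyMeasurable ?_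
    filter_upwards [ae_isProfileIn_glue_update hμV hh i hr] with q hq
    have := hM.alloc_mem j _ hq i
    rw [norm_mul, Real.norm_eq_abs, Real.norm_eq_abs, abs_of_nonneg this.1]
    exact mul_le_of_le_one_right (abs_nonneg _) this.2
  refine (hx.add hsr).congr (.of_forall fun q => ?_)
  simp only [Pi.add_apply, utilityFrom]
  ring

/-- Integrating out the future first turns later utility into the advance built into the payment.
The iterated integral is legitimate for every `r ∈ V j` by `integrable_utilityFrom`. -/
lemma interimUtility_afterHistory (hM : M.IsAdmissible V μ)
    (hμV : ∀ k, ∀ᵐ t ∂(μ k), t ∈ V k) (hh : IsProfileIn V h) (i : Fin n)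
    (hp : Integrable (fun q => M.pay j (glue j h q.1 q.2) i)
      ((stageLaw n (μ j)).prod (jointLaw n μ)))
    (hB : Integrable (fun q => M.laterUtility j (glue j h q.1 q.2) i)
      ((stageLaw n (μ j)).prod (jointLaw n μ))) (t : ℝ) {r : ℝ} (hr : r ∈ V j) :
    (M.afterHistory μ j h).interimUtility (μ j) i t r = M.continuationUtility μ j i h t r := by
  have hint := hM.integrable_utilityFrom hμV hh i hp hB t hr
  rw [hM.continuationUtility_eq, expect_eq_integral hint, integral_prod _ hint,
    ← expect_eq_integral hint.integral_prod_left]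
  refine expect_congr_ae ?_
  filter_upwards [hint.prod_right_ae] with w hw
  simp only [utilityFrom, hM.alloc_glue j h (Function.update w i r),
    hM.pay_glue j h (Function.update w i r)] at hw ⊢
  -- The stage-`j` part does not depend on the future `u`, so integrability of the sum passes to the
  -- later utility.
  have hB' : Integrable (fun u => M.laterUtility j (glue j h (Function.update w i r) u) i)
      (jointLaw n μ) := by
    exact (integrable_add_iff_integrable_right (integrable_const _)).1 hw
  rw [integral_add (integrable_const _) hB', integral_const, probReal_univ, one_smul]
  simp only [afterHistory]
  ring

lemma isAdmissible_afterHistory (hM : M.IsAdmissible V μ)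
    (hμV : ∀ k, ∀ᵐ t ∂(μ k), t ∈ V k) (hh : IsProfileIn V h)
    (hp : ∀ i, Integrable (fun q => M.pay j (glue j h q.1 q.2) i)
      ((stageLaw n (μ j)).prod (jointLaw n μ)))
    (hB : ∀ i, Integrable (fun q => M.laterUtility j (glue j h q.1 q.2) i)
      ((stageLaw n (μ j)).prod (jointLaw n μ))) :
    (M.afterHistory μ j h).IsAdmissible (V j) (μ j) where
  measurable_alloc := (hM.measurable_alloc j).comp ((measurable_glue j).comp
    (measurable_const.prodMk (measurable_id.prodMk measurable_const)))
  measurable_pay := by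
    refine measurable_pi_lambda _ fun i => Measurable.sub ?_ ?_
    · exact (measurable_pi_iff.1 (hM.measurable_pay j) i).comp ((measurable_glue j).comp
        (measurable_const.prodMk (measurable_id.prodMk measurable_const)))
    · have : Measurable fun q : (Fin n → ℝ) × Profile m n =>
          M.laterUtility j (glue j h q.1 q.2) i := (hM.measurable_laterUtility j i).comp
        ((measurable_glue j).comp (measurable_const.prodMk measurable_id))
      exact this.stronglyMeasurable.integral_prod_right.measurable
  integrable_pay i := by
    refine Integrable.sub ?_ (hB i).integral_prod_left
    have := (hp i).integral_prod_left
    simpa only [hM.pay_glue j h, integral_const, probReal_univ, one_smul] using this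
  alloc_mem w hw i := hM.alloc_mem j _ (hh.glue hw hh) i
  sum_alloc_le w hw := hM.sum_alloc_le j _ (hh.glue hw hh)
  incentiveCompatible i t ht r hr := by
    rw [hM.interimUtility_afterHistory hμV hh i (hp i) (hB i) t hr,
      hM.interimUtility_afterHistory hμV hh i (hp i) (hB i) t ht]
    exact hM.periodicIC i j h hh t ht r hr
  exPostIR w hw i := by
    have h₁ := hM.exPostIR i j _ (hh.glue hw hh)
    have h₂ : 0 ≤ ∫ u, M.laterUtility j (glue j h w u) i ∂(jointLaw n μ) :=
      integral_nonneg_of_ae ((ae_jointLaw_isProfileIn hμV).mono fun u hu =>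
        hM.laterUtility_nonneg j i (hh.glue hw hu))
    rw [glue_self] at h₁
    simp only [afterHistory]
    linarith

lemma revenue_afterHistory (hM : M.IsAdmissible V μ)
    (hp : ∀ i, Integrable (fun q => M.pay j (glue j h q.1 q.2) i)
      ((stageLaw n (μ j)).prod (jointLaw n μ)))
    (hB : ∀ i, Integrable (fun q => M.laterUtility j (glue j h q.1 q.2) i)
      ((stageLaw n (μ j)).prod (jointLaw n μ))) :
    (M.afterHistory μ j h).revenue (μ j) =
      ∫ q, ∑ i, (M.pay j (glue j h q.1 q.2) i - M.laterUtility j (glue j h q.1 q.2) i)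
        ∂((stageLaw n (μ j)).prod (jointLaw n μ)) := by
  have hint : Integrable (fun q : (Fin n → ℝ) × Profile m n =>
      ∑ i, (M.pay j (glue j h q.1 q.2) i - M.laterUtility j (glue j h q.1 q.2) i))
      ((stageLaw n (μ j)).prod (jointLaw n μ)) :=
    integrable_finsetSum _ fun i _ => (hp i).sub (hB i)
  rw [integral_prod _ hint]
  refine integral_congr_ae ?_
  filter_upwards [ae_all_iff.2 fun i => (hB i).prod_right_ae] with w hw
  simp only [afterHistory, hM.pay_glue j h w]
  have hi : ∀ i ∈ Finset.univ, Integrable (fun u =>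
      M.pay j (glue j h w h) i - M.laterUtility j (glue j h w u) i) (jointLaw n μ) :=
    fun i _ => (integrable_const _).sub (hw i)
  rw [integral_finsetSum _ hi]
  refine Finset.sum_congr rfl fun i _ => ?_
  rw [integral_sub (integrable_const _) (hw i), integral_const, probReal_univ, one_smul]

end IsAdmissible

end Mechanism

/-! ### Welfare bounds and averaging over histories -/

section Bounds

variable {m n : ℕ}

/-- Never selling is admissible. The bound also excludes the value `⊥` in later extended-real sums.
-/
lemma myerson_nonneg (n : ℕ) (V : Set ℝ) (ν : Measure ℝ) : 0 ≤ myerson n V ν := by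
  have h : (⟨fun _ _ => 0, fun _ _ => 0⟩ : StaticMechanism n).IsAdmissible V ν :=
    { measurable_alloc := measurable_const
      measurable_pay := measurable_const
      integrable_pay := fun i => integrable_zero _ _ _
      alloc_mem := fun w _ i => by simp
      sum_alloc_le := fun w _ => by simp
      incentiveCompatible := fun i t _ r _ => by simp [StaticMechanism.interimUtility]
      exPostIR := fun w _ i => by simp }
  refine le_trans ?_ (le_iSup₂ (f := fun (M : StaticMechanism n) (_ : M.IsAdmissible V ν) =>
    (M.revenue ν : EReal)) _ h)
  simp [StaticMechanism.revenue]

lemma measurable_max (n : ℕ) : Measurable fun w : Fin n → ℝ => ⨆ i, w i :=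
  Measurable.iSup fun i => measurable_pi_apply i

lemma ae_max_nonneg {V : Set ℝ} {ν : Measure ℝ} [IsProbabilityMeasure ν]
    (hV₀ : ∀ t ∈ V, 0 ≤ t) (hV : ∀ᵐ t ∂ν, t ∈ V) : ∀ᵐ w ∂(stageLaw n ν), 0 ≤ ⨆ i, w i :=
  (ae_stageLaw_mem hV).mono fun _ hw => Real.iSup_nonneg fun i => hV₀ _ (hw i)

lemma expectedMax_nonneg {V : Set ℝ} {ν : Measure ℝ} [IsProbabilityMeasure ν]
    (hV₀ : ∀ t ∈ V, 0 ≤ t) (hV : ∀ᵐ t ∂ν, t ∈ V) : 0 ≤ expectedMax n ν := by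
  have : ∫⁻ w, ENNReal.ofReal (-⨆ i, w i) ∂(stageLaw n ν) = 0 := by
    rw [lintegral_congr_ae ((ae_max_nonneg hV₀ hV).mono fun w hw =>
      ENNReal.ofReal_of_nonpos (neg_nonpos.2 hw)), lintegral_zero]
  rw [expectedMax, expect, this, EReal.coe_ennreal_zero, sub_zero]
  exact EReal.coe_ennreal_nonneg _

namespace Mechanism.IsAdmissible

variable {M : Mechanism m n} {V : Fin m → Set ℝ} {μ : Fin m → Measure ℝ}

lemma sum_value_mul_alloc_le_max (hM : M.IsAdmissible V μ) (hV₀ : ∀ k, ∀ t ∈ V k, 0 ≤ t)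
    (k : Fin m) {v : Profile m n} (hv : IsProfileIn V v) :
    ∑ i, v k i * M.alloc k v i ≤ ⨆ i, v k i := by
  calc ∑ i, v k i * M.alloc k v i ≤ ∑ i, (⨆ a, v k a) * M.alloc k v i :=
        Finset.sum_le_sum fun i _ => mul_le_mul_of_nonneg_right
          (le_ciSup (Set.finite_range _).bddAbove i) (hM.alloc_mem k v hv i).1
    _ = (⨆ a, v k a) * ∑ i, M.alloc k v i := (Finset.mul_sum _ _ _).symm
    _ ≤ ⨆ a, v k a := mul_le_of_le_one_right (Real.iSup_nonneg fun i => hV₀ k _ (hv k i))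
        (hM.sum_alloc_le k v hv)

lemma sum_pay_le_max (hM : M.IsAdmissible V μ) (hV₀ : ∀ k, ∀ t ∈ V k, 0 ≤ t)
    (k : Fin m) {v : Profile m n} (hv : IsProfileIn V v) :
    ∑ i, M.pay k v i ≤ ⨆ i, v k i :=
  (Finset.sum_le_sum fun i _ => sub_nonneg.1 (hM.exPostIR i k v hv)).trans
    (hM.sum_value_mul_alloc_le_max hV₀ k hv)

/-- The revenue exceeds the revenue of stage `j` net of the later utilities by at most the
welfare of the other stages. -/
lemma sum_pay_le (hM : M.IsAdmissible V μ) (hV₀ : ∀ k, ∀ t ∈ V k, 0 ≤ t)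
    (j : Fin m) {v : Profile m n} (hv : IsProfileIn V v) :
    ∑ k, ∑ i, M.pay k v i ≤
      ∑ i, (M.pay j v i - M.laterUtility j v i) + ∑ k ∈ Finset.univ.erase j, ⨆ i, v k i := by
  have hlater : ∑ i, M.laterUtility j v i =
      ∑ k ∈ Finset.univ.erase j, if j < k then ∑ i, M.stageUtility k v i else 0 := by
    unfold laterUtility
    rw [Finset.sum_comm, ← Finset.sum_filter]
    refine Finset.sum_congr ?_ fun _ _ => rfl
    ext k
    simp only [Finset.mem_Ioi, Finset.mem_filter, Finset.mem_erase, Finset.mem_univ, and_true]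
    exact ⟨fun hk => ⟨hk.ne', hk⟩, fun hk => hk.2⟩
  rw [← Finset.add_sum_erase _ _ (Finset.mem_univ j), Finset.sum_sub_distrib, hlater, sub_add,
    ← Finset.sum_sub_distrib, sub_eq_add_neg, ← Finset.sum_neg_distrib]
  refine add_le_add_right (Finset.sum_le_sum fun k _ => ?_) _
  -- After `j`, payments plus utilities are the welfare of stage `k`; before `j`, no utility is
  -- available and ex-post IR alone bounds the payments.
  split_ifs with hk
  · have h := hM.sum_value_mul_alloc_le_max hV₀ k hv
    simp only [stageUtility, Finset.sum_sub_distrib]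
    linarith
  · have h := hM.sum_pay_le_max hV₀ k hv
    linarith

variable [∀ k, IsProbabilityMeasure (μ k)] {j : Fin m}

lemma integrable_stageUtility (hM : M.IsAdmissible V μ) (hV₀ : ∀ k, ∀ t ∈ V k, 0 ≤ t)
    (hμV : ∀ k, ∀ᵐ t ∂(μ k), t ∈ V k) {k : Fin m}
    (hmax : Integrable (fun w => ⨆ i, w i) (stageLaw n (μ k))) (i : Fin n) :
    Integrable (fun v => M.stageUtility k v i) (jointLaw n μ) := by
  have hmax' : Integrable (fun v : Profile m n => ⨆ i, v k i) (jointLaw n μ) :=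
    (measurePreserving_eval (fun k => stageLaw n (μ k)) k).integrable_comp_of_integrable hmax
  refine Integrable.sub (hmax'.mono' ?_ ?_) (hM.integrable_pay k i)
  · have := measurable_pi_iff.1 (hM.measurable_alloc k) i
    exact Measurable.aestronglyMeasurable (by fun_prop)
  · filter_upwards [ae_jointLaw_isProfileIn hμV] with v hv
    have hx := hM.alloc_mem k v hv i
    have hvi := hV₀ k _ (hv k i)
    rw [Real.norm_of_nonneg (mul_nonneg hvi hx.1)]
    exact (mul_le_of_le_one_right hvi hx.2).trans (le_ciSup (Set.finite_range _).bddAbove i)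

/-- For almost every history the inner integral is the revenue of an admissible one-shot auction;
the bound is then averaged over histories. -/
lemma integral_virtual_revenue_le (hM : M.IsAdmissible V μ)
    (hμV : ∀ k, ∀ᵐ t ∂(μ k), t ∈ V k)
    (hB : ∀ i, Integrable (fun v => M.laterUtility j v i) (jointLaw n μ)) :
    ((∫ v, ∑ i, (M.pay j v i - M.laterUtility j v i) ∂(jointLaw n μ) : ℝ) : EReal) ≤
      myerson n (V j) (μ j) := by
  have hmp := measurePreserving_glue (n := n) μ j
  have hint : Integrable (fun v => ∑ i, (M.pay j v i - M.laterUtility j v i)) (jointLaw n μ) :=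
    integrable_finsetSum _ fun i _ => (hM.integrable_pay j i).sub (hB i)
  have hint' := hmp.integrable_comp_of_integrable hint
  induction hc : myerson n (V j) (μ j) with
  | bot => exact absurd hc ((EReal.bot_lt_zero.trans_le (myerson_nonneg n (V j) (μ j))).ne')
  | top => exact le_top
  | coe c =>
    rw [EReal.coe_le_coe_iff, ← hmp.map_eq,
      integral_map hmp.measurable.aemeasurable (by rw [hmp.map_eq]; exact hint.aestronglyMeasurable)]
    have hprod := integral_prod _ hint'
    simp only [Function.comp_def] at hprod
    rw [hprod]
    have hle : ∀ᵐ h ∂(jointLaw n μ), ∫ q, ∑ i, (M.pay j (glue j h q.1 q.2) i -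
        M.laterUtility j (glue j h q.1 q.2) i) ∂((stageLaw n (μ j)).prod (jointLaw n μ)) ≤ c := by
      filter_upwards [ae_jointLaw_isProfileIn hμV,
        ae_all_iff.2 fun i =>
          (hmp.integrable_comp_of_integrable (hM.integrable_pay j i)).prod_right_ae,
        ae_all_iff.2 fun i => (hmp.integrable_comp_of_integrable (hB i)).prod_right_ae]
        with h hh hp hB
      rw [← hM.revenue_afterHistory hp hB, ← EReal.coe_le_coe_iff, ← hc]
      exact le_iSup₂ (f := fun (N : StaticMechanism n) (_ : N.IsAdmissible (V j) (μ j)) =>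
        (N.revenue (μ j) : EReal)) _ (hM.isAdmissible_afterHistory hμV hh hp hB)
    simpa using integral_mono_ae hint'.integral_prod_left (integrable_const c) hle

/-- Values of stage `j` itself may have infinite mean: stage `j` enters only through its payments,
which are integrable, and later utilities involve only stages after `j`. -/
lemma revenue_le (hM : M.IsAdmissible V μ) (hV₀ : ∀ k, ∀ t ∈ V k, 0 ≤ t)
    (hμV : ∀ k, ∀ᵐ t ∂(μ k), t ∈ V k)
    (hmax : ∀ k ≠ j, Integrable (fun w => ⨆ i, w i) (stageLaw n (μ k))) :
    (M.revenue μ : EReal) ≤ myerson n (V j) (μ j) +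
      ∑ k ∈ Finset.univ.erase j, expectedMax n (μ k) := by
  have hB : ∀ i, Integrable (fun v => M.laterUtility j v i) (jointLaw n μ) := fun i =>
    integrable_finsetSum _ fun k hk =>
      hM.integrable_stageUtility hV₀ hμV (hmax k (Finset.mem_Ioi.1 hk).ne') i
  have hR : Integrable (fun v => ∑ i, (M.pay j v i - M.laterUtility j v i)) (jointLaw n μ) :=
    integrable_finsetSum _ fun i _ => (hM.integrable_pay j i).sub (hB i)
  have hmp := fun k => measurePreserving_eval (fun k => stageLaw n (μ k)) k
  have hmax' : ∀ k ∈ Finset.univ.erase j,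
      Integrable (fun v : Profile m n => ⨆ i, v k i) (jointLaw n μ) := fun k hk =>
    (hmp k).integrable_comp_of_integrable (hmax k (Finset.ne_of_mem_erase hk))
  have hE : ∀ k ∈ Finset.univ.erase j, expectedMax n (μ k) =
      ((∫ v, ⨆ i, v k i ∂(jointLaw n μ) : ℝ) : EReal) := fun k hk => by
    rw [← expect_eq_integral (hmax' k hk)]
    exact (expect_comp (hmp k) (measurable_max n)).symm
  have hle : M.revenue μ ≤ ∫ v, ∑ i, (M.pay j v i - M.laterUtility j v i) ∂(jointLaw n μ) +
      ∑ k ∈ Finset.univ.erase j, ∫ v, ⨆ i, v k i ∂(jointLaw n μ) := by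
    rw [← integral_finsetSum _ hmax', ← integral_add hR (integrable_finsetSum _ hmax')]
    refine integral_mono_ae (integrable_finsetSum _ fun k _ => integrable_finsetSum _ fun i _ =>
      hM.integrable_pay k i) (hR.add (integrable_finsetSum _ hmax')) ?_
    filter_upwards [ae_jointLaw_isProfileIn hμV] with v hv
    exact hM.sum_pay_le hV₀ j hv
  rw [Finset.sum_congr rfl hE]
  calc (M.revenue μ : EReal)
      ≤ ((∫ v, ∑ i, (M.pay j v i - M.laterUtility j v i) ∂(jointLaw n μ) +
          ∑ k ∈ Finset.univ.erase j, ∫ v, ⨆ i, v k i ∂(jointLaw n μ) : ℝ) : EReal) :=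
        EReal.coe_le_coe_iff.2 hle
    _ = ((∫ v, ∑ i, (M.pay j v i - M.laterUtility j v i) ∂(jointLaw n μ) : ℝ) : EReal) +
          ∑ k ∈ Finset.univ.erase j, ((∫ v, ⨆ i, v k i ∂(jointLaw n μ) : ℝ) : EReal) := by
        rw [EReal.coe_add]
        congr 1
        exact map_sum (⟨⟨Real.toEReal, EReal.coe_zero⟩, EReal.coe_add⟩ : ℝ →+ EReal) _ _
    _ ≤ _ := add_le_add_left (hM.integral_virtual_revenue_le hμV hB) _

end Mechanism.IsAdmissible

end Bounds

end

end DynAuction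

theorem mainTheorem4 (m n : ℕ) (hm : 0 < m) (hn : 0 < n)
    (V : Fin m → Set ℝ) (hVmeas : ∀ k, MeasurableSet (V k)) (hVnonneg : ∀ k, ∀ t ∈ V k, 0 ≤ t)
    (μ : Fin m → MeasureTheory.Measure ℝ) [∀ k, MeasureTheory.IsProbabilityMeasure (μ k)]
    (hμV : ∀ k, ∀ᵐ t ∂(μ k), t ∈ V k) :
    DynAuction.opt n V μ ≤
      ⨅ j : Fin m, (DynAuction.myerson n (V j) (μ j) +
        ∑ k ∈ Finset.univ.erase j, DynAuction.expectedMax n (μ k)) := by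
  refine iSup₂_le fun M hM => le_iInf fun j => ?_
  -- An infinite expected maximum makes the bound trivial. Otherwise all maxima outside `j` are
  -- integrable.
  by_cases htop : ∃ k ∈ Finset.univ.erase j, DynAuction.expectedMax n (μ k) = ⊤
  · obtain ⟨k, hk, htop⟩ := htop
    have hsum : ∑ k ∈ Finset.univ.erase j, DynAuction.expectedMax n (μ k) = ⊤ := by
      rw [eq_top_iff, ← htop]
      exact Finset.single_le_sum
        (fun l _ => DynAuction.expectedMax_nonneg (hVnonneg l) (hμV l)) hk
    -- Since `⊥ + ⊤ = ⊥` in `EReal`, nonnegativity of the Myerson revenue is needed here.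
    rw [hsum, EReal.add_top_of_ne_bot]
    · exact le_top
    · exact (EReal.bot_lt_zero.trans_le (DynAuction.myerson_nonneg n (V j) (μ j))).ne'
  · push Not at htop
    refine hM.revenue_le hVnonneg hμV fun k hk => ?_
    exact DynAuction.integrable_of_expect_ne_top
      (DynAuction.measurable_max n).aestronglyMeasurable (MeasureTheory.integrable_zero _ _ _)
      (DynAuction.ae_max_nonneg (hVnonneg k) (hμV k))
      (htop k (Finset.mem_erase.2 ⟨hk, Finset.mem_univ k⟩))
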